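/- **Setting.** Let $\underline s<\overline s$, $\Delta=\{(s_1,s_2)\in\mathbb R^2:\underline s\le s_1\le s_2\le\overline s\}$, and let $P=L^2(\Delta)^\ell$ with its product Hilbert norm. For $i=1,\dots,\ell$ let $\gamma_i:\mathbb R\to\mathbb R$ be a bounded, globally Lipschitz, nondecreasing (ridge) function and let $w_i:\Delta\to\mathbb R$ be continuous (initial memory). For $s=(s_1,s_2)\in\Delta$ let $t\mapsto\kappa_i(s,t,f)$ be the output of the generalized play operator with input $f$: for a piecewise linear $f$ with breakpoints $0=t_0<\dots<t_N$, the initial value is $\kappa_i(s,0,f)=\max\{\gamma_i(f(0)-s_2),\min\{w_i(s),\gamma_i(f(0)-s_1)\}\}$ and, for $t\in[t_{n-1},t_n]$, $$\kappa_i(s,t,f)=\begin{cases}\max\{\kappa_i(s,t_{n-1},f),\,\gamma_i(f(t)-s_2)\}& f\text{ nondecreasing on }[t_{n-1},t_n],\\ \min\{\kappa_i(s,t_{n-1},f),\,\gamma_i(f(t)-s_1)\}& f\text{ nonincreasing on }[t_{n-1},t_n];\end{cases}$$ this is extended to all continuous $f$ by uniform approximation. Put $(h_if)(t)\circ\nu=\iint_\Delta\kappa_i(s,t,f)\,\nu(s)\,ds$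 for $\nu\in L^2(\Delta)$ and, for continuous maps $a:\mathbb R^m\to\mathbb R$ and $b:\mathbb R^m\to\mathbb R^{q\times\ell}$, $$(\mathcal HX)(t)\circ\mu=b(X(t))\,\bigl((h_1(a\circ X))(t)\circ\mu_1,\dots,(h_\ell(a\circ X))(t)\circ\mu_\ell\bigr)^{\mathsf T}\in\mathbb R^q,\qquad \mu\in P.$$ **Approximation.** Refine $\Delta$ regularly: each triangle is divided into four by joining the midpoints of its edges. Let $\Delta_{j,k}$, $1\le k\le4^j$, be the triangles of level $j$, let $V_j\subset L^2(\Delta)$ be the span of their characteristic functions, let $\Pi_j$ be the orthogonal projection of $P$ onto $V_j^\ell$, and choose arbitrary points $\xi_{j,k}\in\Delta_{j,k}$. Let $\mathcal H_j$ be defined as $\mathcal H$ is, with $\kappa_i(s,t,f)$ replaced by $\sum_k 1_{\Delta_{j,k}}(s)\,\kappa_i(\xi_{j,k},t,f)$. **Theorem.** Let $T>0$, $A\in\mathbb R^{m\times m}$, $B\in\mathbb R^{m\times q}$, $u:[0,T]\to\mathbb R^q$, $\mu,\mu_0\in P$, and let $X\in C([0,T],\mathbb R^m)$ solve $\dot X=AX+B\bigl((\mathcal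 HX)(t)\circ\mu+u\bigr)$ on $[0,T]$. Let $(\hat X,\hat\mu)$ and, for $j=0,1,2,\dots$, $(\hat X_j,\hat\mu_j)$ be solutions on $[0,T]$, with values in $\mathbb R^m\times P$, of $$\dot{\hat X}=A\hat X+B\bigl((\mathcal HX)(t)\circ\hat\mu+u\bigr),\qquad \dot{\hat\mu}=-\bigl(B(\mathcal HX)(t)\bigr)^*\hat X,\qquad \hat X(0)=X(0),\ \hat\mu(0)=\mu_0,$$ $$\dot{\hat X}_j=A\hat X_j+B\bigl((\mathcal H_jX)(t)\Pi_j\circ\hat\mu_j+u\bigr),\qquad \dot{\hat\mu}_j=-\bigl(B(\mathcal H_jX)(t)\Pi_j\bigr)^*\hat X_j,\qquad \hat X_j(0)=X(0),\ \hat\mu_j(0)=\Pi_j\mu_0.$$ Then, as $j\to\infty$, $$\|\hat X-\hat X_j\|_{C([0,T],\mathbb R^m)}\to0,\qquad \|\hat\mu-\hat\mu_j\|_{C([0,T],P)}\to0.$$ The same conclusion holds if, in both update laws, the state estimates $\hat X$ and $\hat X_j$ on the right-hand side are replaced by the observed state $X$. -/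

import Mathlib

open MeasureTheory Set Filter Topology

noncomputable section

namespace HystEst

/-! ### The domain of the distributed parameters and its regular refinement -/

/-- The triangle `Δ = {(s₁, s₂) : smin ≤ s₁ ≤ s₂ ≤ smax}`. -/
def triangle (smin smax : ℝ) : Set (ℝ × ℝ) :=
  {s | smin ≤ s.1 ∧ s.1 ≤ s.2 ∧ s.2 ≤ smax}

/-- Lebesgue measure on the triangle. -/
abbrev triMeasure (smin smax : ℝ) : Measure (ℝ × ℝ) :=
  volume.restrict (triangle smin smax)

/-- The space `L²(Δ)`. -/
abbrev L2Tri (smin smax : ℝ) : Type :=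
  Lp ℝ 2 (triMeasure smin smax)

/-- The Hilbert space `P = L²(Δ) × ⋯ × L²(Δ)` (`l` factors) of distributed parameters. -/
abbrev ParamSpace (smin smax : ℝ) (l : ℕ) : Type :=
  PiLp 2 (fun _ : Fin l => L2Tri smin smax)

/-- The vertices of the four triangles obtained from the triangle with vertices `p` by joining
the midpoints of its edges: three corner triangles and the central one. -/
def childVertices (p : Fin 3 → ℝ × ℝ) : Fin 4 → Fin 3 → ℝ × ℝ :=
  ![![p 0, midpoint ℝ (p 0) (p 1), midpoint ℝ (p 0) (p 2)],
    ![midpoint ℝ (p 0) (p 1), p 1, midpoint ℝ (p 1) (p 2)],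
    ![midpoint ℝ (p 0) (p 2), midpoint ℝ (p 1) (p 2), p 2],
    ![midpoint ℝ (p 0) (p 1), midpoint ℝ (p 1) (p 2), midpoint ℝ (p 0) (p 2)]]

/-- The vertices of the level-`j` triangle `Δ_{i₁ ⋯ i_j}`, which is child number `i_j` of the
triangle `Δ_{i₁ ⋯ i_{j-1}}`. -/
def cellVertices (smin smax : ℝ) : (j : ℕ) → (Fin j → Fin 4) → Fin 3 → ℝ × ℝ
  | 0, _ => ![(smin, smin), (smin, smax), (smax, smax)]
  | j + 1, k => childVertices (cellVertices smin smax j (Fin.init k)) (k (Fin.last j))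

/-- The closed level-`j` triangle with address `k = (i₁, …, i_j)`. -/
def cell (smin smax : ℝ) (j : ℕ) (k : Fin j → Fin 4) : Set (ℝ × ℝ) :=
  convexHull ℝ (range (cellVertices smin smax j k))

theorem measurableSet_cell (smin smax : ℝ) (j : ℕ) (k : Fin j → Fin 4) :
    MeasurableSet (cell smin smax j k) :=
  ((finite_range _).isCompact_convexHull (𝕜 := ℝ)).isClosed.measurableSet

theorem isClosed_triangle (smin smax : ℝ) : IsClosed (triangle smin smax) := by
  have h : triangle smin smax
      = {s : ℝ × ℝ | smin ≤ s.1} ∩ ({s | s.1 ≤ s.2} ∩ {s | s.2 ≤ smax}) := rfl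
  rw [h]
  exact (isClosed_le continuous_const continuous_fst).inter
    ((isClosed_le continuous_fst continuous_snd).inter
      (isClosed_le continuous_snd continuous_const))

theorem isCompact_triangle (smin smax : ℝ) : IsCompact (triangle smin smax) := by
  refine (isCompact_Icc (a := ((smin, smin) : ℝ × ℝ)) (b := (smax, smax))).of_isClosed_subset
    (isClosed_triangle _ _) ?_
  rintro ⟨x, y⟩ ⟨h1, h2, h3⟩
  simp only at h1 h2 h3
  exact ⟨⟨h1, h1.trans h2⟩, ⟨h2.trans h3, h3⟩⟩

instance (smin smax : ℝ) : IsFiniteMeasure (triMeasure smin smax) :=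
  ⟨by rw [Measure.restrict_apply_univ]; exact (isCompact_triangle smin smax).measure_lt_top⟩

/-- The characteristic function of a level-`j` triangle, as an element of `L²(Δ)`. -/
def cellIndicator (smin smax : ℝ) (j : ℕ) (k : Fin j → Fin 4) : L2Tri smin smax :=
  indicatorConstLp 2 (measurableSet_cell smin smax j k) (measure_ne_top _ _) (1 : ℝ)

/-- The space `V_j ⊆ L²(Δ)` of piecewise constant functions on the level-`j` grid. -/
def pwConst (smin smax : ℝ) (j : ℕ) : Submodule ℝ (L2Tri smin smax) :=
  Submodule.span ℝ (range (cellIndicator smin smax j))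

instance (smin smax : ℝ) (j : ℕ) : FiniteDimensional ℝ (pwConst smin smax j) :=
  FiniteDimensional.span_of_finite ℝ (finite_range _)

/-- The orthogonal projection `Π_j` of `P` onto `V_j × ⋯ × V_j`. It acts in each factor as the
orthogonal projection of `L²(Δ)` onto `V_j`. -/
def gridProj (smin smax : ℝ) (l j : ℕ) :
    ParamSpace smin smax l →L[ℝ] ParamSpace smin smax l :=
  (PiLp.continuousLinearEquiv 2 ℝ (fun _ : Fin l => L2Tri smin smax)).symm.toContinuousLinearMap ∘L
    ContinuousLinearMap.pi (fun i =>
      (pwConst smin smax j).starProjection ∘L PiLp.proj 2 (fun _ : Fin l => L2Tri smin smax) i)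

/-! ### The generalized play operator -/

/-- The play recursion along the successive values `v 0, v 1, …` of a piecewise linear input at its
breakpoints, with right curve `γ (· - s₂)` and left curve `γ (· - s₁)`. The stored memory value `w`
is first put between the two curves. -/
def playRec (γ : ℝ → ℝ) (s : ℝ × ℝ) (w : ℝ) (v : ℕ → ℝ) : ℕ → ℝ
  | 0 => max (γ (v 0 - s.2)) (min w (γ (v 0 - s.1)))
  | n + 1 =>
    if v n ≤ v (n + 1) then max (playRec γ s w v n) (γ (v (n + 1) - s.2))
    else min (playRec γ s w v n) (γ (v (n + 1) - s.1))

/-- The value at time `t` of the play operator for the piecewise linear interpolant of `f` with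
breakpoints `k t / N`, `k = 0, …, N`. -/
def playPL (γ : ℝ → ℝ) (s : ℝ × ℝ) (w : ℝ) (f : ℝ → ℝ) (t : ℝ) (N : ℕ) : ℝ :=
  playRec γ s w (fun k => f (k * t / N)) N

/-- The value at time `t` of the play operator for a continuous input `f`: the limit of its values
for the piecewise linear interpolants of `f` on `[0, t]`, which converge uniformly to `f`. The
limit exists by `tendsto_playPL`. Only the values of `f` on `[0, t]` matter. -/
def play (γ : ℝ → ℝ) (s : ℝ × ℝ) (w : ℝ) (f : ℝ → ℝ) (t : ℝ) : ℝ :=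
  limUnder atTop (playPL γ s w f t)

section PlayFacts

theorem playRec_mem {γ : ℝ → ℝ} (hγ : Monotone γ)
    {s : ℝ × ℝ} (hs : s.1 ≤ s.2) (w : ℝ) (v : ℕ → ℝ) (n : ℕ) :
    γ (v n - s.2) ≤ playRec γ s w v n ∧ playRec γ s w v n ≤ γ (v n - s.1) := by
  have hb : ∀ x, γ (x - s.2) ≤ γ (x - s.1) := fun x => hγ (by linarith)
  induction n with
  | zero => exact ⟨le_max_left _ _, max_le (hb _) (min_le_right _ _)⟩
  | succ n ih =>
    simp only [playRec]
    split_ifs with h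
    · exact ⟨le_max_right _ _, max_le (ih.2.trans (hγ (by linarith))) (hb _)⟩
    · exact ⟨le_min ((hγ (by linarith)).trans ih.1) (hb _), min_le_right _ _⟩

theorem playRec_succ {γ : ℝ → ℝ} (hγ : Monotone γ)
    {s : ℝ × ℝ} (hs : s.1 ≤ s.2) (w : ℝ) (v : ℕ → ℝ) (n : ℕ) :
    playRec γ s w v (n + 1)
      = max (γ (v (n + 1) - s.2)) (min (playRec γ s w v n) (γ (v (n + 1) - s.1))) := by
  have ih := playRec_mem hγ hs w v n
  conv_lhs => rw [playRec]
  split_ifs with h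
  · rw [min_eq_left (ih.2.trans (hγ (by linarith))), max_comm]
  · have h1 : γ (v (n + 1) - s.2) ≤ playRec γ s w v n := (hγ (by linarith)).trans ih.1
    have h2 : γ (v (n + 1) - s.2) ≤ γ (v (n + 1) - s.1) := hγ (by linarith)
    rw [max_eq_right (le_min h1 h2)]

theorem abs_clip_sub_le {a a' b b' w w' ε : ℝ} (ha : |a - a'| ≤ ε) (hb : |b - b'| ≤ ε)
    (hw : |w - w'| ≤ ε) : |max a (min w b) - max a' (min w' b')| ≤ ε :=
  (abs_max_sub_max_le_max _ _ _ _).trans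
    (max_le ha ((abs_min_sub_min_le_max _ _ _ _).trans (max_le hw hb)))

theorem abs_playRec_sub_le {γ : ℝ → ℝ} (hγ : Monotone γ)
    {s s' : ℝ × ℝ} (hs : s.1 ≤ s.2) (hs' : s'.1 ≤ s'.2) {w w' ε : ℝ}
    {v v' : ℕ → ℝ} (hw : |w - w'| ≤ ε) (n : ℕ)
    (h1 : ∀ k ≤ n, |γ (v k - s.1) - γ (v' k - s'.1)| ≤ ε)
    (h2 : ∀ k ≤ n, |γ (v k - s.2) - γ (v' k - s'.2)| ≤ ε) :
    |playRec γ s w v n - playRec γ s' w' v' n| ≤ ε := by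
  induction n with
  | zero => exact abs_clip_sub_le (h2 0 le_rfl) (h1 0 le_rfl) hw
  | succ n ih =>
    rw [playRec_succ hγ hs, playRec_succ hγ hs']
    exact abs_clip_sub_le (h2 _ le_rfl) (h1 _ le_rfl)
      (ih (fun k hk => h1 k (by omega)) (fun k hk => h2 k (by omega)))

theorem playRec_stutter {γ : ℝ → ℝ} (hγ : Monotone γ)
    {s : ℝ × ℝ} (hs : s.1 ≤ s.2) (w : ℝ) (v : ℕ → ℝ) (d n : ℕ) :
    playRec γ s w (fun k => v (k / d)) n = playRec γ s w v (n / d) := by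
  induction n with
  | zero => simp [playRec]
  | succ n ih =>
    rw [playRec_succ hγ hs, ih]
    rw [Nat.succ_div]
    split_ifs with h
    · rw [playRec_succ hγ hs]
    · have := playRec_mem hγ hs w v (n / d)
      rw [add_zero, min_eq_left this.2, max_eq_right this.1]

theorem abs_playPL_sub_le {γ : ℝ → ℝ} (hγ : Monotone γ)
    {K : NNReal} (hK : LipschitzWith K γ) {s : ℝ × ℝ} (hs : s.1 ≤ s.2)
    (w : ℝ) {f : ℝ → ℝ} {t ε : ℝ} (ht : 0 ≤ t) {N d : ℕ} (hN : 0 < N) (hd : 0 < d)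
    (hf : ∀ x ∈ Icc 0 t, ∀ y ∈ Icc 0 t, |x - y| ≤ t / N → |f x - f y| ≤ ε) :
    |playPL γ s w f t N - playPL γ s w f t (N * d)| ≤ K * ε := by
  have hNr : (0 : ℝ) < N := by exact_mod_cast hN
  have hdr : (0 : ℝ) < d := by exact_mod_cast hd
  have e : playPL γ s w f t N
      = playRec γ s w (fun k => f (((k / d : ℕ) : ℝ) * t / N)) (N * d) := by
    rw [playPL, playRec_stutter hγ hs w (fun k => f ((k : ℝ) * t / N)) d (N * d),
      Nat.mul_div_cancel _ hd]
  have hval : ∀ k ≤ N * d,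
      |f (((k / d : ℕ) : ℝ) * t / N) - f ((k : ℝ) * t / ((N * d : ℕ) : ℝ))| ≤ ε := by
    intro k hk
    have hq : k / d ≤ N := Nat.div_le_of_le_mul (by rw [mul_comm]; exact hk)
    have hqr : ((k / d : ℕ) : ℝ) ≤ N := by exact_mod_cast hq
    have hkr : (k : ℝ) ≤ N * d := by exact_mod_cast hk
    have h1 : ((k / d : ℕ) : ℝ) * d ≤ k := by exact_mod_cast Nat.div_mul_le_self k d
    have h2 : (k : ℝ) ≤ ((k / d : ℕ) : ℝ) * d + d := by
      have := (Nat.lt_div_mul_add hd (a := k)).le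
      exact_mod_cast this
    push_cast
    have e1 : ((k / d : ℕ) : ℝ) * t / N - (k : ℝ) * t / (N * d)
        = (((k / d : ℕ) : ℝ) * d - k) / d * (t / N) := by
      field_simp
    refine hf _ ⟨by positivity, ?_⟩ _ ⟨by positivity, ?_⟩ ?_
    · rw [div_le_iff₀ hNr, mul_comm]; exact mul_le_mul_of_nonneg_left hqr ht
    · rw [div_le_iff₀ (by positivity), mul_comm]; exact mul_le_mul_of_nonneg_left hkr ht
    · rw [e1, abs_mul, abs_of_nonneg (div_nonneg ht hNr.le), abs_div, abs_of_pos hdr]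
      refine mul_le_of_le_one_left (div_nonneg ht hNr.le) ?_
      rw [div_le_one hdr, abs_le]
      constructor <;> linarith
  have hlip : ∀ x y c : ℝ, |x - y| ≤ ε → |γ (x - c) - γ (y - c)| ≤ K * ε := by
    intro x y c h
    have := hK.dist_le_mul (x - c) (y - c)
    rw [Real.dist_eq, Real.dist_eq, sub_sub_sub_cancel_right] at this
    exact this.trans (mul_le_mul_of_nonneg_left h K.2)
  have hε : 0 ≤ ε := (abs_nonneg _).trans (hval 0 (Nat.zero_le _))
  rw [e, playPL]
  exact abs_playRec_sub_le hγ hs hs (by simpa using mul_nonneg K.2 hε) _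
    (fun k hk => hlip _ _ _ (hval k hk)) (fun k hk => hlip _ _ _ (hval k hk))

/-- The limit that defines `play` exists. -/
theorem tendsto_playPL {γ : ℝ → ℝ} (hγ : Monotone γ)
    {K : NNReal} (hK : LipschitzWith K γ) {s : ℝ × ℝ} (hs : s.1 ≤ s.2)
    (w : ℝ) {f : ℝ → ℝ} {t : ℝ} (ht : 0 ≤ t) (hf : ContinuousOn f (Icc 0 t)) :
    Tendsto (playPL γ s w f t) atTop (𝓝 (play γ s w f t)) := by
  refine CauchySeq.tendsto_limUnder ?_
  rw [Metric.cauchySeq_iff]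
  intro ε hε
  have hK0 : (0 : ℝ) ≤ K := K.2
  obtain ⟨δ, hδ, hu⟩ := Metric.uniformContinuousOn_iff.1
    (isCompact_Icc.uniformContinuousOn_of_continuous hf) (ε / (3 * (K + 1))) (by positivity)
  obtain ⟨N₀, hN₀⟩ := exists_nat_gt (t / δ)
  have key : ∀ N ≥ N₀ + 1, ∀ d, 0 < d →
      |playPL γ s w f t N - playPL γ s w f t (N * d)| ≤ ε / 3 := by
    intro N hN d hd
    have hN0 : 0 < N := by omega
    have hNr : (0 : ℝ) < N := by exact_mod_cast hN0
    have hlt : t / N < δ := by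
      rw [div_lt_iff₀ hNr, mul_comm, ← div_lt_iff₀ hδ]
      exact hN₀.trans_le (by exact_mod_cast (by omega : N₀ ≤ N))
    refine (abs_playPL_sub_le hγ hK hs w ht hN0 hd
      (fun x hx y hy hxy => (hu x hx y hy ?_).le)).trans ?_
    · rw [Real.dist_eq]; exact hxy.trans_lt hlt
    · rw [mul_div_assoc', div_le_div_iff₀ (by positivity) (by norm_num)]
      nlinarith
  refine ⟨N₀ + 1, fun N hN M hM => ?_⟩
  have h1 := key N hN M (by omega)
  have h2 := key M hM N (by omega)
  rw [mul_comm] at h2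
  rw [Real.dist_eq]
  have := abs_sub_le (playPL γ s w f t N) (playPL γ s w f t (N * M)) (playPL γ s w f t M)
  rw [abs_sub_comm (playPL γ s w f t (N * M))] at this
  linarith

theorem abs_play_sub_le {γ : ℝ → ℝ} (hγ : Monotone γ)
    {K : NNReal} (hK : LipschitzWith K γ) {s s' : ℝ × ℝ} (hs : s.1 ≤ s.2)
    (hs' : s'.1 ≤ s'.2) {w w' ε : ℝ} {f : ℝ → ℝ} {t : ℝ} (ht : 0 ≤ t)
    (hf : ContinuousOn f (Icc 0 t)) (hw : |w - w'| ≤ ε)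
    (h1 : K * |s.1 - s'.1| ≤ ε) (h2 : K * |s.2 - s'.2| ≤ ε) :
    |play γ s w f t - play γ s' w' f t| ≤ ε := by
  have hlip : ∀ x a b : ℝ, |γ (x - a) - γ (x - b)| ≤ K * |a - b| := by
    intro x a b
    have := hK.dist_le_mul (x - a) (x - b)
    rwa [Real.dist_eq, Real.dist_eq, sub_sub_sub_cancel_left, abs_sub_comm b] at this
  refine le_of_tendsto ((tendsto_playPL hγ hK hs w ht hf).sub
    (tendsto_playPL hγ hK hs' w' ht hf)).abs (Eventually.of_forall fun N => ?_)
  exact abs_playRec_sub_le hγ hs hs' hw _ (fun k _ => (hlip _ _ _).trans h1)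
    (fun k _ => (hlip _ _ _).trans h2)

theorem abs_play_le {γ : ℝ → ℝ} (hγ : Monotone γ)
    {K : NNReal} (hK : LipschitzWith K γ) {C : ℝ} (hC : ∀ x, |γ x| ≤ C)
    {s : ℝ × ℝ} (hs : s.1 ≤ s.2) (w : ℝ) {f : ℝ → ℝ} {t : ℝ} (ht : 0 ≤ t)
    (hf : ContinuousOn f (Icc 0 t)) : |play γ s w f t| ≤ C := by
  refine le_of_tendsto (tendsto_playPL hγ hK hs w ht hf).abs (Eventually.of_forall fun N => ?_)
  have := playRec_mem hγ hs w (fun k => f (k * t / N)) N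
  exact abs_le.2 ⟨(abs_le.1 (hC _)).1.trans this.1, this.2.trans (abs_le.1 (hC _)).2⟩

end PlayFacts

/-! ### History dependent operators -/

/-- The data of an elementary hysteresis kernel on `Δ`: a globally Lipschitz, bounded,
nondecreasing ridge function and a continuous initial memory. -/
structure HysteresisKernel (smin smax : ℝ) where
  /-- the ridge function `γ` -/
  ridge : ℝ → ℝ
  /-- the stored memory value of each elementary play at time `0` -/
  memory : ℝ × ℝ → ℝ
  ridge_mono : Monotone ridge
  ridge_lipschitz : ∃ K : NNReal, LipschitzWith K ridge
  ridge_bounded : ∃ C : ℝ, ∀ x, |ridge x| ≤ C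
  memory_continuousOn : ContinuousOn memory (triangle smin smax)

variable {smin smax : ℝ}

/-- The kernel `κ(s, t, f)`. -/
def HysteresisKernel.kappa (𝓚 : HysteresisKernel smin smax) (s : ℝ × ℝ) (t : ℝ) (f : C(ℝ, ℝ)) : ℝ :=
  play 𝓚.ridge s (𝓚.memory s) f t

/-- The level-`j` kernel `∑ₖ 1_{Δ_{j,k}}(s) κ(ξ_{j,k}, t, f)`, from one-point quadrature. -/
def HysteresisKernel.kappaGrid (𝓚 : HysteresisKernel smin smax) (j : ℕ)
    (ξ : (Fin j → Fin 4) → ℝ × ℝ) (s : ℝ × ℝ) (t : ℝ) (f : C(ℝ, ℝ)) : ℝ :=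
  ∑ k : Fin j → Fin 4, (cell smin smax j k).indicator (fun _ => 𝓚.kappa (ξ k) t f) s

theorem HysteresisKernel.continuousOn_kappa (𝓚 : HysteresisKernel smin smax) {t : ℝ} (ht : 0 ≤ t)
    (f : C(ℝ, ℝ)) : ContinuousOn (fun s => 𝓚.kappa s t f) (triangle smin smax) := by
  obtain ⟨K, hK⟩ := 𝓚.ridge_lipschitz
  intro s hs
  have hmem := 𝓚.memory_continuousOn s hs
  have hg : Tendsto (fun s' : ℝ × ℝ => max |𝓚.memory s' - 𝓚.memory s|
      (max (K * |s'.1 - s.1|) (K * |s'.2 - s.2|))) (𝓝[triangle smin smax] s) (𝓝 0) := by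
    have t1 : Tendsto (fun s' : ℝ × ℝ => |𝓚.memory s' - 𝓚.memory s|)
        (𝓝[triangle smin smax] s) (𝓝 0) := by
      have h : Tendsto (fun s' : ℝ × ℝ => 𝓚.memory s' - 𝓚.memory s) (𝓝[triangle smin smax] s)
          (𝓝 (𝓚.memory s - 𝓚.memory s)) := Tendsto.sub hmem tendsto_const_nhds
      simpa using h.abs
    have t2 : Tendsto (fun s' : ℝ × ℝ => max ((K : ℝ) * |s'.1 - s.1|) (K * |s'.2 - s.2|))
        (𝓝[triangle smin smax] s) (𝓝 0) := by
      have : Continuous (fun s' : ℝ × ℝ => max ((K : ℝ) * |s'.1 - s.1|) (K * |s'.2 - s.2|)) := by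
        fun_prop
      simpa using (this.tendsto s).mono_left nhdsWithin_le_nhds
    simpa using t1.max t2
  refine tendsto_iff_dist_tendsto_zero.2 (squeeze_zero' (Eventually.of_forall fun _ => dist_nonneg)
    ?_ hg)
  filter_upwards [self_mem_nhdsWithin] with s' hs'
  exact abs_play_sub_le 𝓚.ridge_mono hK hs'.2.1 hs.2.1 ht f.continuous.continuousOn
    (le_max_left _ _) ((le_max_left _ _).trans (le_max_right _ _))
    ((le_max_right _ _).trans (le_max_right _ _))

theorem HysteresisKernel.memLp_kappa (𝓚 : HysteresisKernel smin smax) {t : ℝ} (ht : 0 ≤ t)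
    (f : C(ℝ, ℝ)) : MemLp (fun s => 𝓚.kappa s t f) 2 (triMeasure smin smax) := by
  obtain ⟨K, hK⟩ := 𝓚.ridge_lipschitz
  obtain ⟨C, hC⟩ := 𝓚.ridge_bounded
  have hm := (isClosed_triangle smin smax).measurableSet
  refine MemLp.of_bound ((𝓚.continuousOn_kappa ht f).aestronglyMeasurable hm) C ?_
  filter_upwards [ae_restrict_mem hm] with s hs
  exact abs_play_le 𝓚.ridge_mono hK hC hs.2.1 _ ht f.continuous.continuousOn

theorem HysteresisKernel.memLp_kappaGrid (𝓚 : HysteresisKernel smin smax) (j : ℕ)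
    (ξ : (Fin j → Fin 4) → ℝ × ℝ) (t : ℝ) (f : C(ℝ, ℝ)) :
    MemLp (fun s => 𝓚.kappaGrid j ξ s t f) 2 (triMeasure smin smax) :=
  memLp_finsetSum _ fun k _ => (memLp_const _).indicator (measurableSet_cell smin smax j k)

/-- The functional `ν ↦ ∬_Δ k(s) ν(s) ds` on `L²(Δ)`. -/
def integralFunctional {k : ℝ × ℝ → ℝ} (hk : MemLp k 2 (triMeasure smin smax)) :
    L2Tri smin smax →L[ℝ] ℝ :=
  innerSL ℝ (hk.toLp k)

theorem integralFunctional_apply {k : ℝ × ℝ → ℝ} (hk : MemLp k 2 (triMeasure smin smax))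
    (ν : L2Tri smin smax) :
    integralFunctional hk ν = ∫ s in triangle smin smax, k s * ν s := by
  rw [integralFunctional, innerSL_apply_apply, L2.inner_def]
  refine integral_congr_ae ?_
  filter_upwards [hk.coeFn_toLp] with s hs
  rw [hs]
  simp [mul_comm]

/-- The functional `(h f)(t) ∈ L²(Δ)*`, `(h f)(t) ∘ ν = ∬_Δ κ(s, t, f) ν(s) ds`, at `t ≥ 0`. -/
def HysteresisKernel.op (𝓚 : HysteresisKernel smin smax) (f : C(ℝ, ℝ)) {t : ℝ} (ht : 0 ≤ t) :
    L2Tri smin smax →L[ℝ] ℝ :=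
  integralFunctional (𝓚.memLp_kappa ht f)

/-- The level-`j` functional `(h_j f)(t) ∘ ν = ∬_Δ ∑ₖ 1_{Δ_{j,k}}(s) κ(ξ_{j,k}, t, f) ν(s) ds`. -/
def HysteresisKernel.opGrid (𝓚 : HysteresisKernel smin smax) (j : ℕ)
    (ξ : (Fin j → Fin 4) → ℝ × ℝ) (f : C(ℝ, ℝ)) (t : ℝ) : L2Tri smin smax →L[ℝ] ℝ :=
  integralFunctional (𝓚.memLp_kappaGrid j ξ t f)

/-- The operator of a real matrix between Euclidean spaces. -/
def matOp {m n : ℕ} (M : Matrix (Fin m) (Fin n) ℝ) :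
    EuclideanSpace ℝ (Fin n) →L[ℝ] EuclideanSpace ℝ (Fin m) :=
  (Matrix.toEuclideanLin M).toContinuousLinearMap

/-- The diagonal operator `μ ↦ (φ₁ μ₁, …, φ_l μ_l)` from `P` to `ℝ^l`. -/
def diagOp {l : ℕ} (φ : Fin l → L2Tri smin smax →L[ℝ] ℝ) :
    ParamSpace smin smax l →L[ℝ] EuclideanSpace ℝ (Fin l) :=
  (EuclideanSpace.equiv (Fin l) ℝ).symm.toContinuousLinearMap ∘L
    ContinuousLinearMap.pi (fun i => φ i ∘L PiLp.proj 2 (fun _ : Fin l => L2Tri smin smax) i)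

/-- `(𝓗 X)(t) = b(X(t)) diag(h₁(a ∘ X)(t), …, h_l(a ∘ X)(t))`, an operator from `P` to `ℝ^q`. -/
def histOp {m q l : ℕ} (𝓚 : Fin l → HysteresisKernel smin smax)
    (a : C(EuclideanSpace ℝ (Fin m), ℝ))
    (b : C(EuclideanSpace ℝ (Fin m), Matrix (Fin q) (Fin l) ℝ))
    (X : C(ℝ, EuclideanSpace ℝ (Fin m))) {t : ℝ} (ht : 0 ≤ t) :
    ParamSpace smin smax l →L[ℝ] EuclideanSpace ℝ (Fin q) :=
  matOp (b (X t)) ∘L diagOp (fun i => (𝓚 i).op (a.comp X) ht)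

/-- `(𝓗_j X)(t) = b(X(t)) diag(h_{1,j}(a ∘ X)(t), …, h_{l,j}(a ∘ X)(t)) Π_j`.
As `Π_j` is idempotent, this is also the operator written `(𝓗_j X)(t) Π_j`. -/
def histOpGrid {m q l : ℕ} (𝓚 : Fin l → HysteresisKernel smin smax)
    (a : C(EuclideanSpace ℝ (Fin m), ℝ))
    (b : C(EuclideanSpace ℝ (Fin m), Matrix (Fin q) (Fin l) ℝ))
    (j : ℕ) (ξ : (Fin j → Fin 4) → ℝ × ℝ)
    (X : C(ℝ, EuclideanSpace ℝ (Fin m))) (t : ℝ) :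
    ParamSpace smin smax l →L[ℝ] EuclideanSpace ℝ (Fin q) :=
  matOp (b (X t)) ∘L diagOp (fun i => (𝓚 i).opGrid j ξ (a.comp X) t) ∘L gridProj smin smax l j

/-! ### Plant and estimators -/

/-- `X` solves the state equation `X' = A X + B ((𝓗 X)(t) ∘ μ + u)` on `[0, T]`, where `H t` is
`(𝓗 X)(t)`. -/
def IsPlantSolution {m q l : ℕ} (A : Matrix (Fin m) (Fin m) ℝ) (B : Matrix (Fin m) (Fin q) ℝ)
    (u : ℝ → EuclideanSpace ℝ (Fin q)) (T : ℝ)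
    (H : ∀ t : ℝ, 0 ≤ t → ParamSpace smin smax l →L[ℝ] EuclideanSpace ℝ (Fin q))
    (μ : ParamSpace smin smax l) (X : ℝ → EuclideanSpace ℝ (Fin m)) : Prop :=
  ∀ t (ht : t ∈ Icc 0 T),
    HasDerivWithinAt X (matOp A (X t) + matOp B (H t ht.1 μ + u t)) (Icc 0 T) t

/-- `(Y, ν)` solves on `[0, T]` the estimator equations
`Y' = A Y + B (H(t) ν + u)`, `ν' = -(B H(t))* Z(t)`, `Y(0) = x₀`, `ν(0) = ν₀`;
the signal `Z` drives the parameter update law. -/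
structure IsEstimator {m q l : ℕ} (A : Matrix (Fin m) (Fin m) ℝ) (B : Matrix (Fin m) (Fin q) ℝ)
    (u : ℝ → EuclideanSpace ℝ (Fin q)) (T : ℝ)
    (H : ∀ t : ℝ, 0 ≤ t → ParamSpace smin smax l →L[ℝ] EuclideanSpace ℝ (Fin q))
    (x₀ : EuclideanSpace ℝ (Fin m)) (ν₀ : ParamSpace smin smax l)
    (Z : ℝ → EuclideanSpace ℝ (Fin m))
    (Y : ℝ → EuclideanSpace ℝ (Fin m)) (ν : ℝ → ParamSpace smin smax l) : Prop where
  state_init : Y 0 = x₀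
  param_init : ν 0 = ν₀
  state_deriv : ∀ t (ht : t ∈ Icc 0 T),
    HasDerivWithinAt Y (matOp A (Y t) + matOp B (H t ht.1 (ν t) + u t)) (Icc 0 T) t
  param_deriv : ∀ t (ht : t ∈ Icc 0 T),
    HasDerivWithinAt ν (-(ContinuousLinearMap.adjoint (matOp B ∘L H t ht.1) (Z t))) (Icc 0 T) t

end HystEst

end

open Set Filter HystEst

open MeasureTheory Set Filter Topology

noncomputable section

namespace HystEst

variable {smin smax : ℝ}

/-! ### Geometry of the regular refinement -/

/-! Both estimators take their history operator along the same observed path `X`, so they are affine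
evolution equations with prescribed coefficients. Their solutions stay close on `[0, T]` by
Gronwall's inequality once the coefficients are close in operator norm, uniformly in time, and the
initial data are close.

Operators. The play recursion is nonexpansive in the sup norm of its data, so `κ(s, t, f)` varies
with `s` by at most the larger of the change of the memory and the Lipschitz constant of the ridge
times the change of `s`. This modulus of continuity does not depend on `t`. One-point quadrature on
small cells is therefore accurate uniformly in `t` (`eventually_norm_op_sub_opGrid_le`). The factor
`Π_j`, which tends to the identity only strongly, does no harm: the grid kernel lies in `V_j`, so
`Π_j` can be dropped (`opGrid_starProjection`).

Initial data. `Π_j μ₀ → μ₀`, because continuous functions are dense in `L²(Δ)` and uniformly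
continuous on `Δ` (`tendsto_gridProj`).

Geometry. Every cell is a homothetic copy of `Δ` with ratio `± 2⁻ʲ` (`cell_eq_image`). This gives
its diameter and its area, and the areas show that cells overlap only in null sets.

Error estimate. `IsEstimator.norm_sub_le` uses bounds on the limit solution only. The approximations
need no a priori bound. -/

theorem mem_convexHull_range_fin_three {E : Type*} [AddCommGroup E] [Module ℝ E]
    {p : Fin 3 → E} {x : E} :
    x ∈ convexHull ℝ (range p) ↔ ∃ α β γ : ℝ, 0 ≤ α ∧ 0 ≤ β ∧ 0 ≤ γ ∧ α + β + γ = 1 ∧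
      x = α • p 0 + β • p 1 + γ • p 2 := by
  constructor
  · intro hx
    refine convexHull_min (t := {x | ∃ α β γ : ℝ, 0 ≤ α ∧ 0 ≤ β ∧ 0 ≤ γ ∧ α + β + γ = 1 ∧
      x = α • p 0 + β • p 1 + γ • p 2}) ?_ ?_ hx
    · rintro _ ⟨i, rfl⟩
      fin_cases i
      · exact ⟨1, 0, 0, by simp⟩
      · exact ⟨0, 1, 0, by simp⟩
      · exact ⟨0, 0, 1, by simp⟩
    · rintro _ ⟨α, β, γ, h1, h2, h3, h4, rfl⟩ _ ⟨α', β', γ', h1', h2', h3', h4', rfl⟩ c d hc hd hcd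
      refine ⟨c * α + d * α', c * β + d * β', c * γ + d * γ', by positivity, by positivity,
        by positivity, ?_, by module⟩
      linear_combination c * h4 + d * h4' + hcd
  · rintro ⟨α, β, γ, hα, hβ, hγ, h, rfl⟩
    have := (convex_convexHull ℝ (range p)).sum_mem (t := Finset.univ) (w := ![α, β, γ]) (z := p)
      (by intro i _; fin_cases i <;> simpa) (by simpa [Fin.sum_univ_three] using h)
      (fun i _ => subset_convexHull ℝ _ (mem_range_self i))
    simpa [Fin.sum_univ_three] using this

theorem midpoint_eq_half_smul (x y : ℝ × ℝ) :
    midpoint ℝ x y = (1 / 2 : ℝ) • x + (1 / 2 : ℝ) • y := by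
  rw [midpoint_eq_smul_add, smul_add, invOf_eq_inv, one_div]

/-- If some barycentric coordinate is at least `1/2`, the point lies in the corner triangle at that
vertex. Otherwise all three are below `1/2` and it lies in the central one. -/
theorem exists_mem_convexHull_childVertices {p : Fin 3 → ℝ × ℝ} {x : ℝ × ℝ}
    (hx : x ∈ convexHull ℝ (range p)) :
    ∃ c, x ∈ convexHull ℝ (range (childVertices p c)) := by
  obtain ⟨α, β, γ, hα, hβ, hγ, h, rfl⟩ := mem_convexHull_range_fin_three.1 hx
  simp only [mem_convexHull_range_fin_three]
  by_cases h0 : 1 / 2 ≤ α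
  · refine ⟨0, 2 * α - 1, 2 * β, 2 * γ, by linarith, by linarith, by linarith, by linarith, ?_⟩
    simp only [childVertices, midpoint_eq_half_smul, Matrix.cons_val]
    -- Using `α + β + γ = 1` to make the coefficient homogeneous turns the goal into an identity
    -- that `module` can check.
    rw [show (2 * α - 1) • p 0 = (α - β - γ) • p 0 by congr 1; linarith]
    module
  by_cases h1 : 1 / 2 ≤ β
  · refine ⟨1, 2 * α, 2 * β - 1, 2 * γ, by linarith, by linarith, by linarith, by linarith, ?_⟩
    simp only [childVertices, midpoint_eq_half_smul, Matrix.cons_val]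
    rw [show (2 * β - 1) • p 1 = (β - α - γ) • p 1 by congr 1; linarith]
    module
  by_cases h2 : 1 / 2 ≤ γ
  · refine ⟨2, 2 * α, 2 * β, 2 * γ - 1, by linarith, by linarith, by linarith, by linarith, ?_⟩
    simp only [childVertices, midpoint_eq_half_smul, Matrix.cons_val]
    rw [show (2 * γ - 1) • p 2 = (γ - α - β) • p 2 by congr 1; linarith]
    module
  · refine ⟨3, 1 - 2 * γ, 1 - 2 * α, 1 - 2 * β, by linarith, by linarith, by linarith,
      by linarith, ?_⟩
    simp only [childVertices, midpoint_eq_half_smul, Matrix.cons_val]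
    rw [show 1 - 2 * γ = α + β - γ by linarith, show 1 - 2 * α = β + γ - α by linarith,
      show 1 - 2 * β = α + γ - β by linarith]
    module

theorem convexHull_childVertices_subset (p : Fin 3 → ℝ × ℝ) (c : Fin 4) :
    convexHull ℝ (range (childVertices p c)) ⊆ convexHull ℝ (range p) := by
  have hp : ∀ i, p i ∈ convexHull ℝ (range p) :=
    fun i => subset_convexHull ℝ _ (mem_range_self i)
  have hm : ∀ i j, midpoint ℝ (p i) (p j) ∈ convexHull ℝ (range p) :=
    fun i j => (convex_convexHull ℝ _).midpoint_mem (hp i) (hp j)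
  refine convexHull_min ?_ (convex_convexHull ℝ _)
  rintro _ ⟨i, rfl⟩
  fin_cases c <;> fin_cases i <;> simp [childVertices, hp, hm]

theorem image_add_smul_convexHull_range (w : ℝ × ℝ) (τ : ℝ) (p : Fin 3 → ℝ × ℝ) :
    (fun x => w + τ • x) '' convexHull ℝ (range p)
      = convexHull ℝ (range fun i => w + τ • p i) := by
  have := (AffineMap.const ℝ (ℝ × ℝ) w + τ • AffineMap.id ℝ (ℝ × ℝ)).image_convexHull (range p)
  rw [← range_comp] at this
  exact this

/-- Each of the four small triangles is homothetic to the big one, with ratio `± 1/2`. -/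
theorem convexHull_childVertices_eq_image (p : Fin 3 → ℝ × ℝ) (c : Fin 4) :
    ∃ (w : ℝ × ℝ) (τ : ℝ), |τ| = 1 / 2 ∧
      convexHull ℝ (range (childVertices p c))
        = (fun x => w + τ • x) '' convexHull ℝ (range p) := by
  simp only [image_add_smul_convexHull_range]
  have corner : ∀ i : Fin 3, (childVertices p i.castSucc)
      = fun k => (1 / 2 : ℝ) • p i + (1 / 2 : ℝ) • p k := by
    intro i
    funext k
    fin_cases i <;> fin_cases k <;>
      simp only [childVertices, midpoint_eq_half_smul, Matrix.cons_val, Fin.reduceCastSucc,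
        Fin.zero_eta, Fin.mk_one, Fin.reduceFinMk] <;> module
  induction c using Fin.lastCases with
  | cast i =>
    exact ⟨(1 / 2 : ℝ) • p i, 1 / 2, by norm_num, by rw [corner]⟩
  | last =>
    -- The central triangle is the image under the homothety about the centroid with ratio `-1/2`,
    -- which sends each vertex to the midpoint of the opposite edge. The vertices come out permuted,
    -- so only the ranges agree.
    refine ⟨(1 / 2 : ℝ) • (p 0 + p 1 + p 2), -(1 / 2), by norm_num, ?_⟩
    have e0 : (1 / 2 : ℝ) • (p 0 + p 1 + p 2) + -(1 / 2 : ℝ) • p 0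
      = (1 / 2 : ℝ) • p 1 + (1 / 2 : ℝ) • p 2 := by module
    have e1 : (1 / 2 : ℝ) • (p 0 + p 1 + p 2) + -(1 / 2 : ℝ) • p 1
      = (1 / 2 : ℝ) • p 0 + (1 / 2 : ℝ) • p 2 := by module
    have e2 : (1 / 2 : ℝ) • (p 0 + p 1 + p 2) + -(1 / 2 : ℝ) • p 2
      = (1 / 2 : ℝ) • p 0 + (1 / 2 : ℝ) • p 1 := by module
    have hc : childVertices p (Fin.last 3)
        = (fun i => (1 / 2 : ℝ) • (p 0 + p 1 + p 2) + -(1 / 2 : ℝ) • p i) ∘ ![2, 0, 1] := by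
      funext i
      fin_cases i
      · exact (midpoint_eq_half_smul _ _).trans e2.symm
      · exact (midpoint_eq_half_smul _ _).trans e0.symm
      · exact (midpoint_eq_half_smul _ _).trans e1.symm
    have hsurj : Function.Surjective (![2, 0, 1] : Fin 3 → Fin 3) := by decide
    rw [hc, hsurj.range_comp]

theorem cell_zero {smin smax : ℝ} (hs : smin < smax) (k : Fin 0 → Fin 4) :
    cell smin smax 0 k = triangle smin smax := by
  have hD : 0 < smax - smin := sub_pos.2 hs
  ext ⟨x, y⟩
  simp only [cell, cellVertices, mem_convexHull_range_fin_three, triangle, mem_ofPred_eq,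
    Matrix.cons_val, Prod.smul_mk, Prod.mk_add_mk, Prod.mk.injEq, smul_eq_mul]
  constructor
  · rintro ⟨α, β, γ, hα, hβ, hγ, h, rfl, rfl⟩
    obtain rfl : α = 1 - β - γ := by linarith
    refine ⟨?_, ?_, ?_⟩ <;> nlinarith
  · rintro ⟨h1, h2, h3⟩
    -- The barycentric coordinates are the slacks in the three inequalities defining `Δ`, divided by
    -- `smax - smin`.
    refine ⟨(smax - y) / (smax - smin), (y - x) / (smax - smin), (x - smin) / (smax - smin),
      div_nonneg (by linarith) hD.le, div_nonneg (by linarith) hD.le,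
      div_nonneg (by linarith) hD.le, ?_, ?_, ?_⟩ <;> field_simp <;> ring

theorem cell_subset_triangle {smin smax : ℝ} (hs : smin < smax) (j : ℕ) (k : Fin j → Fin 4) :
    cell smin smax j k ⊆ triangle smin smax := by
  induction j with
  | zero => exact (cell_zero hs k).subset
  | succ j ih => exact (convexHull_childVertices_subset _ _).trans (ih (Fin.init k))

theorem exists_mem_cell {smin smax : ℝ} (hs : smin < smax) {x : ℝ × ℝ}
    (hx : x ∈ triangle smin smax) (j : ℕ) : ∃ k, x ∈ cell smin smax j k := by
  induction j with
  | zero => exact ⟨Fin.elim0, by rwa [cell_zero hs]⟩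
  | succ j ih =>
    obtain ⟨k, hk⟩ := ih
    obtain ⟨c, hc⟩ := exists_mem_convexHull_childVertices hk
    refine ⟨Fin.snoc k c, ?_⟩
    rw [cell, cellVertices, Fin.init_snoc, Fin.snoc_last]
    exact hc

/-- Homotheties compose and their ratios multiply. Both the area and the diameter of a cell are read
off from this. -/
theorem cell_eq_image {smin smax : ℝ} (hs : smin < smax) (j : ℕ) (k : Fin j → Fin 4) :
    ∃ (w : ℝ × ℝ) (τ : ℝ), |τ| = (1 / 2) ^ j ∧
      cell smin smax j k = (fun x => w + τ • x) '' triangle smin smax := by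
  induction j with
  | zero => exact ⟨0, 1, by simp, by simp [cell_zero hs]⟩
  | succ j ih =>
    obtain ⟨w, τ, hτ, h⟩ := ih (Fin.init k)
    obtain ⟨w', τ', hτ', h'⟩ := convexHull_childVertices_eq_image
      (cellVertices smin smax j (Fin.init k)) (k (Fin.last j))
    refine ⟨w' + τ' • w, τ' * τ, by rw [abs_mul, hτ, hτ', pow_succ, mul_comm], ?_⟩
    change convexHull ℝ _ = _
    rw [cellVertices, h']
    change _ '' cell smin smax j (Fin.init k) = _
    rw [h, image_image]
    refine image_congr fun x _ => ?_
    module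

open scoped Pointwise in
theorem volume_cell {smin smax : ℝ} (hs : smin < smax) (j : ℕ) (k : Fin j → Fin 4) :
    volume (cell smin smax j k) = ((4 : ENNReal) ^ j)⁻¹ * volume (triangle smin smax) := by
  obtain ⟨w, τ, hτ, h⟩ := cell_eq_image hs j k
  have e : (fun x => w + τ • x) '' triangle smin smax
      = (fun x => w + x) '' (τ • triangle smin smax) := by
    rw [← image_smul, image_image]
  rw [h, e, image_add_left, measure_preimage_add, Measure.addHaar_smul]
  congr 1
  have : |τ ^ Module.finrank ℝ (ℝ × ℝ)| = ((4 : ℝ) ^ j)⁻¹ := by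
    rw [Module.finrank_prod, Module.finrank_self, abs_pow, hτ, ← pow_mul, mul_comm, pow_mul]
    rw [← inv_pow]
    norm_num
  rw [this, ENNReal.ofReal_inv_of_pos (by positivity), ENNReal.ofReal_pow (by norm_num)]
  norm_num

theorem dist_le_of_mem_cell {smin smax : ℝ} (hs : smin < smax) {j : ℕ} {k : Fin j → Fin 4}
    {x y : ℝ × ℝ} (hx : x ∈ cell smin smax j k) (hy : y ∈ cell smin smax j k) :
    dist x y ≤ (1 / 2) ^ j * Metric.diam (triangle smin smax) := by
  obtain ⟨w, τ, hτ, h⟩ := cell_eq_image hs j k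
  rw [h] at hx hy
  obtain ⟨x, hx, rfl⟩ := hx
  obtain ⟨y, hy, rfl⟩ := hy
  rw [dist_add_left, dist_smul₀, Real.norm_eq_abs, hτ]
  exact mul_le_mul_of_nonneg_left
    (Metric.dist_le_diam_of_mem (isCompact_triangle smin smax).isBounded hx hy) (by positivity)

/-- Almost every point of `Δ` lies in exactly one triangle of level `j`. -/
theorem ae_sum_indicator_cell_eq_one {smin smax : ℝ} (hs : smin < smax) (j : ℕ) :
    ∀ᵐ s ∂triMeasure smin smax,
      ∑ k : Fin j → Fin 4, (cell smin smax j k).indicator (fun _ => (1 : ℝ)) s = 1 := by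
  have hm := (isClosed_triangle smin smax).measurableSet
  have key : (fun _ => (1 : ENNReal)) =ᵐ[triMeasure smin smax]
      fun s => ∑ k : Fin j → Fin 4, (cell smin smax j k).indicator (fun _ => (1 : ENNReal)) s := by
    -- The cells cover `Δ`, so the sum is at least `1` on `Δ`. Its integral is at most `4^j` times
    -- `4^(-j)` times the area of `Δ`, which is the integral of `1`. Hence equality holds almost
    -- everywhere, and the common edges need no separate treatment.
    refine ae_eq_of_ae_le_of_lintegral_le ?_ ?_ ?_ ?_
    · filter_upwards [ae_restrict_mem hm] with s hs'
      obtain ⟨k, hk⟩ := exists_mem_cell hs hs' j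
      refine le_trans ?_ (Finset.single_le_sum (fun _ _ => zero_le) (Finset.mem_univ k))
      rw [indicator_of_mem hk]
    · simpa using (isCompact_triangle smin smax).measure_lt_top.ne
    · exact (Finset.measurable_fun_sum _ fun k _ =>
        measurable_const.indicator (measurableSet_cell smin smax j k)).aemeasurable
    · rw [lintegral_finsetSum _ fun k _ =>
        measurable_const.indicator (measurableSet_cell smin smax j k)]
      calc ∑ k : Fin j → Fin 4, ∫⁻ s, (cell smin smax j k).indicator (fun _ => (1 : ENNReal)) s
            ∂triMeasure smin smax
          ≤ ∑ k : Fin j → Fin 4, ((4 : ENNReal) ^ j)⁻¹ * volume (triangle smin smax) := by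
            refine Finset.sum_le_sum fun k _ => ?_
            rw [lintegral_indicator (measurableSet_cell smin smax j k), setLIntegral_one,
              ← volume_cell hs j k]
            exact Measure.restrict_apply_le _ _
        _ = ∫⁻ _, 1 ∂triMeasure smin smax := by
            rw [Finset.sum_const, Finset.card_univ, Fintype.card_fun, Fintype.card_fin,
              Fintype.card_fin, nsmul_eq_mul, ← mul_assoc]
            push_cast
            rw [ENNReal.mul_inv_cancel (by positivity) (by finiteness)]
            simp
  filter_upwards [key] with s hs'
  have := congrArg ENNReal.toReal hs'
  have hfin : ∀ k ∈ Finset.univ,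
      (cell smin smax j k).indicator (fun _ => (1 : ENNReal)) s ≠ ⊤ := by
    intro k _
    by_cases h : s ∈ cell smin smax j k <;> simp [h]
  rw [ENNReal.toReal_one, ENNReal.toReal_sum hfin] at this
  refine Eq.trans ?_ this.symm
  refine Finset.sum_congr rfl fun k _ => ?_
  by_cases h : s ∈ cell smin smax j k <;> simp [h]

/-- The indicators sum to `1` almost everywhere, so the error is an average of the differences `g s
- g (ξ k)` over cells containing `s`. -/
theorem ae_abs_sum_indicator_cell_sub_le {smin smax : ℝ} (hs : smin < smax) {j : ℕ}
    {ξ : (Fin j → Fin 4) → ℝ × ℝ} (hξ : ∀ k, ξ k ∈ cell smin smax j k) {g : ℝ × ℝ → ℝ} {ε : ℝ}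
    (hg : ∀ k, ∀ s ∈ cell smin smax j k, ∀ s' ∈ cell smin smax j k, |g s - g s'| ≤ ε) :
    ∀ᵐ s ∂triMeasure smin smax,
      |g s - ∑ k : Fin j → Fin 4, (cell smin smax j k).indicator (fun _ => g (ξ k)) s| ≤ ε := by
  filter_upwards [ae_sum_indicator_cell_eq_one hs j] with s h
  have hi : ∀ k (c : ℝ), (cell smin smax j k).indicator (fun _ => c) s
      = (cell smin smax j k).indicator (fun _ => (1 : ℝ)) s * c := by
    intro k c
    by_cases hk : s ∈ cell smin smax j k <;> simp [hk]
  have h0 : ∀ k, 0 ≤ (cell smin smax j k).indicator (fun _ => (1 : ℝ)) s :=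
    fun k => indicator_nonneg (fun _ _ => zero_le_one) _
  have e : g s - ∑ k : Fin j → Fin 4, (cell smin smax j k).indicator (fun _ => g (ξ k)) s
      = ∑ k : Fin j → Fin 4,
        (cell smin smax j k).indicator (fun _ => (1 : ℝ)) s * (g s - g (ξ k)) := by
    simp only [mul_sub, Finset.sum_sub_distrib, ← Finset.sum_mul, h, one_mul]
    simp only [← hi]
  rw [e]
  calc _ ≤ ∑ k : Fin j → Fin 4, |(cell smin smax j k).indicator (fun _ => (1 : ℝ)) s
          * (g s - g (ξ k))| := Finset.abs_sum_le_sum_abs _ _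
    _ ≤ ∑ k : Fin j → Fin 4, (cell smin smax j k).indicator (fun _ => (1 : ℝ)) s * ε := by
        refine Finset.sum_le_sum fun k _ => ?_
        rw [abs_mul, abs_of_nonneg (h0 k)]
        by_cases hk : s ∈ cell smin smax j k
        · exact mul_le_mul_of_nonneg_left (hg k s hk _ (hξ k)) (h0 k)
        · simp [hk]
    _ = ε := by rw [← Finset.sum_mul, h, one_mul]

/-- Uniform continuity on `Δ` gives small oscillation on all triangles of a fine level. -/
theorem eventually_forall_mem_cell_dist_lt {smin smax : ℝ} (hs : smin < smax) {δ : ℝ}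
    (hδ : 0 < δ) : ∀ᶠ j in atTop, ∀ k, ∀ s ∈ cell smin smax j k, ∀ s' ∈ cell smin smax j k,
      dist s s' < δ := by
  have : Tendsto (fun j : ℕ => (1 / 2 : ℝ) ^ j * Metric.diam (triangle smin smax)) atTop
      (𝓝 (0 * Metric.diam (triangle smin smax))) :=
    (tendsto_pow_atTop_nhds_zero_of_lt_one (by norm_num) (by norm_num)).mul_const _
  rw [zero_mul] at this
  filter_upwards [this.eventually_lt_const hδ] with j hj k s hs1 s' hs2
  exact (dist_le_of_mem_cell hs hs1 hs2).trans_lt hj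

/-! ### Piecewise constant approximation in `L²(Δ)` -/

theorem toLp_sum_indicator_cell (j : ℕ) (c : (Fin j → Fin 4) → ℝ)
    (h : MemLp (fun s => ∑ k, (cell smin smax j k).indicator (fun _ => c k) s) 2
      (triMeasure smin smax)) :
    h.toLp _ = ∑ k, c k • cellIndicator smin smax j k := by
  refine Lp.ext ?_
  have h1 : ∀ k, (c k • cellIndicator smin smax j k : L2Tri smin smax) =ᵐ[triMeasure smin smax]
      (cell smin smax j k).indicator (fun _ => c k) := by
    intro k
    filter_upwards [Lp.coeFn_smul (c k) (cellIndicator smin smax j k),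
      indicatorConstLp_coeFn (p := 2) (hs := measurableSet_cell smin smax j k)
        (hμs := measure_ne_top (triMeasure smin smax) _) (c := (1 : ℝ))] with s e1 e2
    rw [e1, Pi.smul_apply, cellIndicator, e2]
    by_cases hk : s ∈ cell smin smax j k <;> simp [hk]
  filter_upwards [h.coeFn_toLp, Lp.coeFn_finsetSum Finset.univ
    (fun k => c k • cellIndicator smin smax j k), ae_all_iff.2 h1] with s e1 e2 e3
  rw [e1, e2, Finset.sum_apply]
  exact Finset.sum_congr rfl fun k _ => (e3 k).symm

theorem toLp_sum_indicator_cell_mem_pwConst (j : ℕ) (c : (Fin j → Fin 4) → ℝ)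
    (h : MemLp (fun s => ∑ k, (cell smin smax j k).indicator (fun _ => c k) s) 2
      (triMeasure smin smax)) :
    h.toLp _ ∈ pwConst smin smax j := by
  rw [toLp_sum_indicator_cell]
  exact Submodule.sum_mem _ fun k _ =>
    Submodule.smul_mem _ _ (Submodule.subset_span (mem_range_self k))

/-- `Δ` has finite measure. One constant, the square root of its area, serves all functions, which
keeps the later bounds uniform in `t`. -/
theorem exists_norm_toLp_sub_toLp_le (smin smax : ℝ) :
    ∃ c : ℝ, 0 ≤ c ∧ ∀ (g g' : ℝ × ℝ → ℝ) (hg : MemLp g 2 (triMeasure smin smax))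
      (hg' : MemLp g' 2 (triMeasure smin smax)) (ε : ℝ), 0 ≤ ε →
      (∀ᵐ s ∂triMeasure smin smax, |g s - g' s| ≤ ε) → ‖hg.toLp g - hg'.toLp g'‖ ≤ c * ε := by
  refine ⟨(measureUnivNNReal (triMeasure smin smax) ^ (2 : ENNReal).toReal⁻¹ : NNReal),
    NNReal.coe_nonneg _, fun g g' hg hg' ε hε h => ?_⟩
  rw [← MemLp.toLp_sub]
  push_cast
  refine Lp.norm_le_of_ae_bound hε ?_
  filter_upwards [h, (hg.sub hg').coeFn_toLp] with s h1 h2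
  rw [h2]
  exact h1

theorem norm_sub_starProjection_le {E : Type*} [NormedAddCommGroup E] [InnerProductSpace ℝ E]
    (U : Submodule ℝ E) [U.HasOrthogonalProjection] (x : E) {y : E} (hy : y ∈ U) :
    ‖x - U.starProjection x‖ ≤ ‖x - y‖ := by
  rw [Submodule.starProjection_minimal]
  exact ciInf_le ⟨0, by rintro _ ⟨z, rfl⟩; exact norm_nonneg _⟩ (⟨y, hy⟩ : U)

/-- The projection is the best approximation from `V_j`, so it suffices to exhibit a good element of
`V_j`: samples of a continuous function close to `f`. -/
theorem tendsto_starProjection_pwConst (hs : smin < smax) (f : L2Tri smin smax) :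
    Tendsto (fun j => (pwConst smin smax j).starProjection f) atTop (𝓝 f) := by
  obtain ⟨c, hc, hcb⟩ := exists_norm_toLp_sub_toLp_le smin smax
  rw [Metric.tendsto_atTop']
  intro ε hε
  obtain ⟨g, hg, hgm⟩ := (Lp.memLp f).exists_boundedContinuous_eLpNorm_sub_le
    (by norm_num) (ε := ENNReal.ofReal (ε / 3)) (by simpa using hε)
  have hfg : ‖f - hgm.toLp g‖ ≤ ε / 3 := by
    rw [← Lp.toLp_coeFn f (Lp.memLp f), ← MemLp.toLp_sub, Lp.norm_toLp]
    exact ENNReal.toReal_le_of_le_ofReal (by positivity) hg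
  obtain ⟨δ, hδ, hu⟩ := Metric.uniformContinuousOn_iff.1
    ((isCompact_triangle smin smax).uniformContinuousOn_of_continuous g.continuous.continuousOn)
    -- The `+ 1` keeps the denominator positive when `c = 0`.
    (ε / (3 * (c + 1))) (by positivity)
  obtain ⟨N, hN⟩ := eventually_atTop.1 (eventually_forall_mem_cell_dist_lt hs hδ)
  refine ⟨N, fun j hj => ?_⟩
  have hξ : ∀ k, cellVertices smin smax j k 0 ∈ cell smin smax j k :=
    fun k => subset_convexHull ℝ _ (mem_range_self 0)
  have hm : MemLp (fun s => ∑ k, (cell smin smax j k).indicator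
      (fun _ => g (cellVertices smin smax j k 0)) s) 2 (triMeasure smin smax) :=
    memLp_finsetSum _ fun k _ => (memLp_const _).indicator (measurableSet_cell smin smax j k)
  have h1 := hcb _ _ hgm hm (ε / (3 * (c + 1))) (by positivity)
    (ae_abs_sum_indicator_cell_sub_le hs hξ fun k s h s' h' =>
      (hu s (cell_subset_triangle hs j k h) s' (cell_subset_triangle hs j k h')
        (hN j hj.le k s h s' h')).le)
  have h2 : c * (ε / (3 * (c + 1))) ≤ ε / 3 := by
    rw [mul_div_assoc', div_le_div_iff₀ (by positivity) (by norm_num)]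
    nlinarith
  rw [dist_comm, dist_eq_norm]
  calc _ ≤ ‖f - hm.toLp _‖ :=
        norm_sub_starProjection_le _ _ (toLp_sum_indicator_cell_mem_pwConst j _ hm)
    _ ≤ ‖f - hgm.toLp g‖ + ‖hgm.toLp g - hm.toLp _‖ := norm_sub_le_norm_sub_add_norm_sub _ _ _
    _ < ε := by linarith

theorem tendsto_gridProj (hs : smin < smax) {l : ℕ} (μ : ParamSpace smin smax l) :
    Tendsto (fun j => gridProj smin smax l j μ) atTop (𝓝 μ) := by
  have h : Tendsto (fun j => fun i => (pwConst smin smax j).starProjection (μ i)) atTop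
      (𝓝 (fun i => μ i)) :=
    tendsto_pi_nhds.2 fun i => tendsto_starProjection_pwConst hs (μ i)
  exact ((PiLp.continuousLinearEquiv 2 ℝ
    (fun _ : Fin l => L2Tri smin smax)).symm.continuous.tendsto _).comp h

/-! ### Convergence of the history dependent operators -/

/-- The projection is self-adjoint and fixes the grid kernel, which is already piecewise constant.
-/
theorem HysteresisKernel.opGrid_starProjection (𝓚 : HysteresisKernel smin smax) (j : ℕ)
    (ξ : (Fin j → Fin 4) → ℝ × ℝ) (f : C(ℝ, ℝ)) (t : ℝ) (ν : L2Tri smin smax) :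
    𝓚.opGrid j ξ f t ((pwConst smin smax j).starProjection ν) = 𝓚.opGrid j ξ f t ν := by
  rw [opGrid, integralFunctional, innerSL_apply_apply, innerSL_apply_apply,
    ← Submodule.inner_starProjection_left_eq_right, Submodule.starProjection_eq_self_iff.2]
  exact toLp_sum_indicator_cell_mem_pwConst j _ _

theorem HysteresisKernel.exists_norm_op_le (𝓚 : HysteresisKernel smin smax) (f : C(ℝ, ℝ)) :
    ∃ M : ℝ, ∀ (t : ℝ) (ht : 0 ≤ t), ‖𝓚.op f ht‖ ≤ M := by
  obtain ⟨c, hc, hcb⟩ := exists_norm_toLp_sub_toLp_le smin smax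
  obtain ⟨K, hK⟩ := 𝓚.ridge_lipschitz
  obtain ⟨C, hC⟩ := 𝓚.ridge_bounded
  refine ⟨c * C, fun t ht => ?_⟩
  rw [op, integralFunctional, innerSL_apply_norm]
  have := hcb _ _ (𝓚.memLp_kappa ht f) MemLp.zero C ((abs_nonneg _).trans (hC 0)) (by
    filter_upwards [ae_restrict_mem (isClosed_triangle smin smax).measurableSet] with s hs
    rw [Pi.zero_apply, sub_zero]
    exact abs_play_le 𝓚.ridge_mono hK hC hs.2.1 _ ht f.continuous.continuousOn)
  rwa [MemLp.toLp_zero, sub_zero] at this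

/-- The oscillation of the kernel on a cell is controlled by the memory and the Lipschitz constant
of the ridge alone, so the level is chosen before `t`. -/
theorem HysteresisKernel.eventually_norm_op_sub_opGrid_le (hs : smin < smax)
    (𝓚 : HysteresisKernel smin smax) (f : C(ℝ, ℝ))
    {ξ : ∀ j : ℕ, (Fin j → Fin 4) → ℝ × ℝ} (hξ : ∀ j k, ξ j k ∈ cell smin smax j k)
    {ε : ℝ} (hε : 0 < ε) :
    ∀ᶠ j in atTop, ∀ (t : ℝ) (ht : 0 ≤ t), ‖𝓚.op f ht - 𝓚.opGrid j (ξ j) f t‖ ≤ ε := by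
  obtain ⟨c, hc, hcb⟩ := exists_norm_toLp_sub_toLp_le smin smax
  obtain ⟨K, hK⟩ := 𝓚.ridge_lipschitz
  have hK0 : (0 : ℝ) ≤ K := K.2
  set η := ε / (c + 1) with hη
  have hη0 : 0 < η := by positivity
  obtain ⟨δ, hδ, hu⟩ := Metric.uniformContinuousOn_iff.1
    ((isCompact_triangle smin smax).uniformContinuousOn_of_continuous 𝓚.memory_continuousOn) η hη0
  have hδ' : 0 < min δ (η / (K + 1)) := by positivity
  filter_upwards [eventually_forall_mem_cell_dist_lt hs hδ'] with j hj t ht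
  have hlip : ∀ x : ℝ, x < η / (K + 1) → K * x ≤ η := by
    intro x hx
    rw [lt_div_iff₀ (by positivity)] at hx
    by_cases h0 : 0 ≤ x <;> nlinarith
  have hosc : ∀ k, ∀ s ∈ cell smin smax j k, ∀ s' ∈ cell smin smax j k,
      |𝓚.kappa s t f - 𝓚.kappa s' t f| ≤ η := by
    intro k s h s' h'
    have hd := hj k s h s' h'
    have hd1 := hd.trans_le (min_le_left _ _)
    have hd2 := hd.trans_le (min_le_right _ _)
    rw [Prod.dist_eq, max_lt_iff, Real.dist_eq, Real.dist_eq] at hd2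
    have hm := cell_subset_triangle hs j k h
    have hm' := cell_subset_triangle hs j k h'
    exact abs_play_sub_le 𝓚.ridge_mono hK hm.2.1 hm'.2.1 ht f.continuous.continuousOn
      (hu s hm s' hm' hd1).le (hlip _ hd2.1) (hlip _ hd2.2)
  rw [op, opGrid, integralFunctional, integralFunctional, ← map_sub, innerSL_apply_norm]
  refine (hcb _ _ (𝓚.memLp_kappa ht f) (𝓚.memLp_kappaGrid j (ξ j) t f) η hη0.le
    (ae_abs_sum_indicator_cell_sub_le hs (hξ j) hosc)).trans ?_
  rw [hη, mul_div_assoc', div_le_iff₀ (by positivity)]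
  nlinarith

/-! ### From functionals on `L²(Δ)` to operators on `P` -/

theorem diagOp_sub {l : ℕ} (φ ψ : Fin l → L2Tri smin smax →L[ℝ] ℝ) :
    diagOp φ - diagOp ψ = diagOp (fun i => φ i - ψ i) := by
  ext μ i
  rfl

theorem norm_diagOp_le {l : ℕ} {φ : Fin l → L2Tri smin smax →L[ℝ] ℝ} {M : ℝ} (hM : 0 ≤ M)
    (hφ : ∀ i, ‖φ i‖ ≤ M) : ‖diagOp φ‖ ≤ M := by
  refine ContinuousLinearMap.opNorm_le_bound _ hM fun μ => ?_
  refine le_of_sq_le_sq ?_ (by positivity)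
  rw [EuclideanSpace.norm_sq_eq, mul_pow, PiLp.norm_sq_eq_of_L2, Finset.mul_sum]
  refine Finset.sum_le_sum fun i _ => ?_
  rw [← mul_pow]
  exact pow_le_pow_left₀ (norm_nonneg _) ((φ i).le_of_opNorm_le (hφ i) (μ i)) 2

theorem histOpGrid_eq {m q l : ℕ} (𝓚 : Fin l → HysteresisKernel smin smax)
    (a : C(EuclideanSpace ℝ (Fin m), ℝ))
    (b : C(EuclideanSpace ℝ (Fin m), Matrix (Fin q) (Fin l) ℝ))
    (j : ℕ) (ξ : (Fin j → Fin 4) → ℝ × ℝ)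
    (X : C(ℝ, EuclideanSpace ℝ (Fin m))) (t : ℝ) :
    histOpGrid 𝓚 a b j ξ X t
      = matOp (b (X t)) ∘L diagOp (fun i => (𝓚 i).opGrid j ξ (a.comp X) t) := by
  have : diagOp (fun i => (𝓚 i).opGrid j ξ (a.comp X) t) ∘L gridProj smin smax l j
      = diagOp (fun i => (𝓚 i).opGrid j ξ (a.comp X) t) := by
    ext μ i
    exact (𝓚 i).opGrid_starProjection j ξ (a.comp X) t (μ i)
  rw [histOpGrid, this]

theorem continuous_matOp {m n : ℕ} :
    Continuous (matOp : Matrix (Fin m) (Fin n) ℝ → _) := by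
  have : (matOp : Matrix (Fin m) (Fin n) ℝ → _)
      = (Matrix.toEuclideanLin.trans LinearMap.toContinuousLinearMap :
        Matrix (Fin m) (Fin n) ℝ ≃ₗ[ℝ] _) := rfl
  rw [this]
  exact LinearMap.continuous_of_finiteDimensional
    (Matrix.toEuclideanLin.trans LinearMap.toContinuousLinearMap :
        Matrix (Fin m) (Fin n) ℝ ≃ₗ[ℝ] _).toLinearMap

section
variable {m q l : ℕ} (𝓚 : Fin l → HysteresisKernel smin smax)
    (a : C(EuclideanSpace ℝ (Fin m), ℝ))
    (b : C(EuclideanSpace ℝ (Fin m), Matrix (Fin q) (Fin l) ℝ))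
    (X : C(ℝ, EuclideanSpace ℝ (Fin m))) (T : ℝ)

theorem exists_norm_matOp_le : ∃ β : ℝ, 0 ≤ β ∧ ∀ t ∈ Icc 0 T, ‖matOp (b (X t))‖ ≤ β := by
  obtain ⟨β, hβ⟩ := (isCompact_Icc (a := (0 : ℝ)) (b := T)).exists_bound_of_continuousOn
    (f := fun t => matOp (b (X t)))
    (continuous_matOp.comp (b.continuous.comp X.continuous)).continuousOn
  exact ⟨max β 0, le_max_right _ _, fun t ht => (hβ t ht).trans (le_max_left _ _)⟩

theorem exists_norm_histOp_le :
    ∃ M : ℝ, 0 ≤ M ∧ ∀ t (ht : t ∈ Icc 0 T), ‖histOp 𝓚 a b X ht.1‖ ≤ M := by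
  obtain ⟨β, hβ0, hβ⟩ := exists_norm_matOp_le b X T
  choose M hM using fun i => (𝓚 i).exists_norm_op_le (a.comp X)
  have hM0 : ∀ i, 0 ≤ M i := fun i => (norm_nonneg _).trans (hM i 0 le_rfl)
  have hS : 0 ≤ ∑ i, M i := Finset.sum_nonneg fun i _ => hM0 i
  refine ⟨β * ∑ i, M i, by positivity, fun t ht => ?_⟩
  refine (ContinuousLinearMap.opNorm_comp_le _ _).trans
    (mul_le_mul (hβ t ht) (norm_diagOp_le hS fun i => ?_) (norm_nonneg _) hβ0)
  exact (hM i t ht.1).trans (Finset.single_le_sum (fun i _ => hM0 i) (Finset.mem_univ i))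

theorem eventually_norm_histOp_sub_histOpGrid_le (hs : smin < smax)
    {ξ : ∀ j : ℕ, (Fin j → Fin 4) → ℝ × ℝ} (hξ : ∀ j k, ξ j k ∈ cell smin smax j k)
    {ε : ℝ} (hε : 0 < ε) :
    ∀ᶠ j in atTop, ∀ t (ht : t ∈ Icc 0 T),
      ‖histOp 𝓚 a b X ht.1 - histOpGrid 𝓚 a b j (ξ j) X t‖ ≤ ε := by
  obtain ⟨β, hβ0, hβ⟩ := exists_norm_matOp_le b X T
  have hη : 0 < ε / (β + 1) := by positivity
  filter_upwards [eventually_all.2 fun i =>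
    (𝓚 i).eventually_norm_op_sub_opGrid_le hs (a.comp X) hξ hη] with j hj t ht
  rw [histOpGrid_eq, histOp, ← ContinuousLinearMap.comp_sub, diagOp_sub]
  refine (ContinuousLinearMap.opNorm_comp_le _ _).trans
    ((mul_le_mul (hβ t ht) (norm_diagOp_le hη.le fun i => hj i t ht.1) (norm_nonneg _) hβ0).trans ?_)
  rw [mul_div_assoc', div_le_iff₀ (by positivity)]
  nlinarith

end

/-! ### The error estimate -/

/-- Gronwall's bound is `η e^{Kt} + (η / K)(e^{Kt} - 1)`. The condition `1 ≤ K` removes the quotient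
and leaves a bound linear in `η`. -/
theorem norm_le_of_norm_derivWithin_le {E : Type*} [NormedAddCommGroup E] [NormedSpace ℝ E]
    {f : ℝ → E} {T K η : ℝ} (hK : 1 ≤ K) (hη : 0 ≤ η) (h0 : ‖f 0‖ ≤ η)
    (h : ∀ t ∈ Icc 0 T, ∃ d, HasDerivWithinAt f d (Icc 0 T) t ∧ ‖d‖ ≤ K * ‖f t‖ + η) :
    ∀ t ∈ Icc 0 T, ‖f t‖ ≤ 2 * η * Real.exp (K * T) := by
  choose! f' hf' hb using h
  intro t ht
  have h1 := norm_le_gronwallBound_of_norm_deriv_right_le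
    (fun t ht => (hf' t ht).continuousWithinAt)
    (fun t ht => (hf' t ⟨ht.1, ht.2.le⟩).mono_of_mem_nhdsWithin (Icc_mem_nhdsGE_of_mem ht)) h0
    (fun t ht => hb t ⟨ht.1, ht.2.le⟩) t ht
  rw [sub_zero, gronwallBound_of_K_ne_0 (by positivity)] at h1
  have h2 : Real.exp (K * t) ≤ Real.exp (K * T) :=
    Real.exp_le_exp.2 (mul_le_mul_of_nonneg_left ht.2 (by positivity))
  have h3 : η / K * (Real.exp (K * t) - 1) ≤ η * Real.exp (K * T) := by
    have h4 : 0 ≤ Real.exp (K * t) - 1 := by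
      have := Real.one_le_exp (mul_nonneg (zero_le_one.trans hK) ht.1)
      linarith
    exact mul_le_mul (div_le_self hη hK) (by linarith) h4 hη
  have h5 : η * Real.exp (K * t) ≤ η * Real.exp (K * T) := mul_le_mul_of_nonneg_left h2 hη
  simp only at h1
  linarith

section
variable {m q l : ℕ} {A : Matrix (Fin m) (Fin m) ℝ} {B : Matrix (Fin m) (Fin q) ℝ}
  {u : ℝ → EuclideanSpace ℝ (Fin q)} {T : ℝ}

/-- Two estimators whose operators, initial parameters and driving signals are close stay close. -/
theorem IsEstimator.norm_sub_le
    {H H' : ∀ t : ℝ, 0 ≤ t → ParamSpace smin smax l →L[ℝ] EuclideanSpace ℝ (Fin q)}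
    {x₀ : EuclideanSpace ℝ (Fin m)} {ν₀ ν₀' : ParamSpace smin smax l}
    {Z Y Z' Y' : ℝ → EuclideanSpace ℝ (Fin m)} {ν ν' : ℝ → ParamSpace smin smax l}
    (h : IsEstimator A B u T H x₀ ν₀ Z Y ν) (h' : IsEstimator A B u T H' x₀ ν₀' Z' Y' ν')
    (hZ : ∀ t ∈ Icc 0 T, ‖Z t - Z' t‖ ≤ ‖Y t - Y' t‖)
    {M R ε : ℝ} (hM : ∀ t (ht : t ∈ Icc 0 T), ‖H t ht.1‖ ≤ M) (hM0 : 0 ≤ M) (hR : 1 ≤ R)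
    (hZR : ∀ t ∈ Icc 0 T, ‖Z t‖ ≤ R) (hνR : ∀ t ∈ Icc 0 T, ‖ν t‖ ≤ R)
    (hε : 0 ≤ ε) (hε1 : ε ≤ 1) (hH : ∀ t (ht : t ∈ Icc 0 T), ‖H t ht.1 - H' t ht.1‖ ≤ ε)
    (hν₀ : ‖ν₀ - ν₀'‖ ≤ ε) :
    ∀ t ∈ Icc 0 T, ‖(Y t - Y' t, ν t - ν' t)‖
      ≤ 2 * ((‖matOp B‖ * R + 1) * ε) *
        Real.exp ((1 + ‖matOp A‖ + ‖matOp B‖ * (M + 1)) * T) := by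
  have hA := norm_nonneg (matOp A)
  have hB := norm_nonneg (matOp B)
  have hmono : ‖matOp B‖ * R * ε ≤ (‖matOp B‖ * R + 1) * ε := by nlinarith
  -- The summand `1` in the growth rate secures `1 ≤ K`. In `η`, the part `‖B‖ R ε` is the
  -- consistency error and the further `ε` covers the initial parameter error.
  refine norm_le_of_norm_derivWithin_le (by nlinarith) (by positivity) ?_ fun t ht => ?_
  · rw [h.state_init, h'.state_init, h.param_init, h'.param_init, sub_self, Prod.norm_mk,
      norm_zero, max_eq_right (norm_nonneg _)]
    nlinarith [mul_nonneg (mul_nonneg hB (zero_le_one.trans hR)) hε]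
  refine ⟨_, ((h.state_deriv t ht).sub (h'.state_deriv t ht)).prodMk
    ((h.param_deriv t ht).sub (h'.param_deriv t ht)), ?_⟩
  set e := ‖(Y t - Y' t, ν t - ν' t)‖ with he
  have he0 : 0 ≤ e := norm_nonneg _
  have hYe : ‖Y t - Y' t‖ ≤ e := norm_fst_le (Y t - Y' t, ν t - ν' t)
  have hνe : ‖ν t - ν' t‖ ≤ e := norm_snd_le (Y t - Y' t, ν t - ν' t)
  have hZe := (hZ t ht).trans hYe
  -- The approximate solution is bounded by the limit solution plus the error itself, and Gronwall
  -- absorbs the latter.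
  have hν' : ‖ν' t‖ ≤ R + e := by
    have := _root_.norm_sub_le (ν t) (ν t - ν' t)
    rw [sub_sub_cancel] at this
    linarith [hνR t ht]
  have hZ' : ‖Z' t‖ ≤ R + e := by
    have := _root_.norm_sub_le (Z t) (Z t - Z' t)
    rw [sub_sub_cancel] at this
    linarith [hZR t ht]
  set G := H t ht.1
  set G' := H' t ht.1
  have hG : ‖G‖ ≤ M := hM t ht
  have hGG : ‖G - G'‖ ≤ ε := hH t ht
  -- The quadratic term `ε e` is at most `e` because `ε ≤ 1`. This is where `M + 1` comes from.
  have hfin : ‖matOp B‖ * (M * e + ε * (R + e))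
      ≤ ‖matOp B‖ * (M + 1) * e + ‖matOp B‖ * R * ε := by
    have : ε * e ≤ 1 * e := mul_le_mul_of_nonneg_right hε1 he0
    nlinarith
  rw [Prod.norm_mk]
  refine max_le ?_ ?_
  · have e1 : matOp A (Y t) + matOp B (G (ν t) + u t) - (matOp A (Y' t) + matOp B (G' (ν' t) + u t))
        = matOp A (Y t - Y' t) + matOp B (G (ν t - ν' t) + (G - G') (ν' t)) := by
      simp only [map_sub, map_add, _root_.sub_apply]
      abel
    rw [e1]
    have s1 : ‖matOp A (Y t - Y' t)‖ ≤ ‖matOp A‖ * e :=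
      (matOp A).le_of_opNorm_le_of_le le_rfl hYe
    have s2 : ‖G (ν t - ν' t) + (G - G') (ν' t)‖ ≤ M * e + ε * (R + e) :=
      norm_add_le_of_le (G.le_of_opNorm_le_of_le hG hνe) ((G - G').le_of_opNorm_le_of_le hGG hν')
    have s3 : ‖matOp B (G (ν t - ν' t) + (G - G') (ν' t))‖ ≤ ‖matOp B‖ * (M * e + ε * (R + e)) :=
      (matOp B).le_of_opNorm_le_of_le le_rfl s2
    refine (norm_add_le_of_le s1 s3).trans ?_
    nlinarith
  · have e1 : -(ContinuousLinearMap.adjoint (matOp B ∘L G) (Z t))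
          - -(ContinuousLinearMap.adjoint (matOp B ∘L G') (Z' t))
        = -(ContinuousLinearMap.adjoint (matOp B ∘L G) (Z t - Z' t)
          + ContinuousLinearMap.adjoint (matOp B ∘L (G - G')) (Z' t)) := by
      rw [ContinuousLinearMap.comp_sub, map_sub, map_sub, _root_.sub_apply]
      abel
    rw [e1, norm_neg]
    have b1 : ‖ContinuousLinearMap.adjoint (matOp B ∘L G)‖ ≤ ‖matOp B‖ * M := by
      rw [LinearIsometryEquiv.norm_map]
      exact (ContinuousLinearMap.opNorm_comp_le _ _).trans (mul_le_mul_of_nonneg_left hG hB)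
    have b2 : ‖ContinuousLinearMap.adjoint (matOp B ∘L (G - G'))‖ ≤ ‖matOp B‖ * ε := by
      rw [LinearIsometryEquiv.norm_map]
      exact (ContinuousLinearMap.opNorm_comp_le _ _).trans (mul_le_mul_of_nonneg_left hGG hB)
    refine (norm_add_le_of_le (ContinuousLinearMap.le_of_opNorm_le_of_le _ b1 hZe)
      (ContinuousLinearMap.le_of_opNorm_le_of_le _ b2 hZ')).trans ?_
    nlinarith

/-- Leaving the signals `Z` and `Z'` free, subject to `hZ`, treats both update laws at once. -/
theorem IsEstimator.tendstoUniformlyOn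
    {H : ∀ t : ℝ, 0 ≤ t → ParamSpace smin smax l →L[ℝ] EuclideanSpace ℝ (Fin q)}
    {H' : ℕ → ∀ t : ℝ, 0 ≤ t → ParamSpace smin smax l →L[ℝ] EuclideanSpace ℝ (Fin q)}
    {x₀ : EuclideanSpace ℝ (Fin m)} {ν₀ : ParamSpace smin smax l}
    {ν₀' : ℕ → ParamSpace smin smax l}
    {Z Y : ℝ → EuclideanSpace ℝ (Fin m)} {ν : ℝ → ParamSpace smin smax l}
    {Z' Y' : ℕ → ℝ → EuclideanSpace ℝ (Fin m)} {ν' : ℕ → ℝ → ParamSpace smin smax l}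
    (h : IsEstimator A B u T H x₀ ν₀ Z Y ν)
    (h' : ∀ j, IsEstimator A B u T (H' j) x₀ (ν₀' j) (Z' j) (Y' j) (ν' j))
    (hZc : ContinuousOn Z (Icc 0 T))
    (hZ : ∀ j, ∀ t ∈ Icc 0 T, ‖Z t - Z' j t‖ ≤ ‖Y t - Y' j t‖)
    (hM : ∃ M : ℝ, 0 ≤ M ∧ ∀ t (ht : t ∈ Icc 0 T), ‖H t ht.1‖ ≤ M)
    (hH : ∀ ε > 0, ∀ᶠ j in atTop, ∀ t (ht : t ∈ Icc 0 T), ‖H t ht.1 - H' j t ht.1‖ ≤ ε)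
    (hν₀ : Tendsto ν₀' atTop (𝓝 ν₀)) :
    TendstoUniformlyOn Y' Y atTop (Icc 0 T) ∧ TendstoUniformlyOn ν' ν atTop (Icc 0 T) := by
  obtain ⟨M, hM0, hM⟩ := hM
  obtain ⟨R₁, hR₁⟩ := isCompact_Icc.exists_bound_of_continuousOn hZc
  obtain ⟨R₂, hR₂⟩ := isCompact_Icc.exists_bound_of_continuousOn
    (fun t ht => (h.param_deriv t ht).continuousWithinAt)
  set R := max 1 (max R₁ R₂)
  have hR : 1 ≤ R := le_max_left _ _
  set C := 2 * (‖matOp B‖ * R + 1) * Real.exp ((1 + ‖matOp A‖ + ‖matOp B‖ * (M + 1)) * T) with hC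
  have hC0 : 0 < C := by positivity
  have key : ∀ δ > 0, ∀ᶠ j in atTop, ∀ t ∈ Icc 0 T, ‖(Y t - Y' j t, ν t - ν' j t)‖ < δ := by
    intro δ hδ
    -- The factor `2` yields the strict inequality in `key`.
    set ε := min 1 (δ / (2 * C))
    have hε : 0 < ε := by positivity
    filter_upwards [hH ε hε, hν₀.eventually (Metric.closedBall_mem_nhds ν₀ hε)] with j hj hj' t ht
    rw [dist_comm, dist_eq_norm] at hj'
    have h1 := h.norm_sub_le (h' j) (hZ j) hM hM0 hR
      (fun t ht => (hR₁ t ht).trans ((le_max_left _ _).trans (le_max_right _ _)))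
      (fun t ht => (hR₂ t ht).trans ((le_max_right _ _).trans (le_max_right _ _)))
      hε.le (min_le_left _ _) hj hj' t ht
    have h2 : C * ε ≤ δ / 2 := by
      refine (mul_le_mul_of_nonneg_left (min_le_right _ _) hC0.le).trans_eq ?_
      field_simp
    have h3 : 2 * ((‖matOp B‖ * R + 1) * ε) *
        Real.exp ((1 + ‖matOp A‖ + ‖matOp B‖ * (M + 1)) * T) = C * ε := by
      rw [hC]; ring
    linarith
  constructor <;> rw [Metric.tendstoUniformlyOn_iff] <;> intro δ hδ <;>
    filter_upwards [key δ hδ] with j hj t ht <;> rw [dist_eq_norm]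
  · exact (norm_fst_le (Y t - Y' j t, ν t - ν' j t)).trans_lt (hj t ht)
  · exact (norm_snd_le (Y t - Y' j t, ν t - ν' j t)).trans_lt (hj t ht)

end

end HystEst

end

/-! ### Convergence of the approximate estimators -/

theorem theorem4 {m q l : ℕ} (smin smax : ℝ) (hs : smin < smax)
    (A : Matrix (Fin m) (Fin m) ℝ) (B : Matrix (Fin m) (Fin q) ℝ)
    (𝓚 : Fin l → HysteresisKernel smin smax)
    (a : C(EuclideanSpace ℝ (Fin m), ℝ))
    (b : C(EuclideanSpace ℝ (Fin m), Matrix (Fin q) (Fin l) ℝ))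
    (ξ : ∀ j : ℕ, (Fin j → Fin 4) → ℝ × ℝ) (hξ : ∀ j k, ξ j k ∈ cell smin smax j k)
    (u : ℝ → EuclideanSpace ℝ (Fin q)) (T : ℝ) (hT : 0 < T)
    (μ μ₀ : ParamSpace smin smax l) (X : C(ℝ, EuclideanSpace ℝ (Fin m)))
    (hX : IsPlantSolution A B u T (fun _ ht => histOp 𝓚 a b X ht) μ X) :
    -- update laws driven by the state estimates
    (∀ (Xh : ℝ → EuclideanSpace ℝ (Fin m)) (μh : ℝ → ParamSpace smin smax l)
        (Xhj : ℕ → ℝ → EuclideanSpace ℝ (Fin m)) (μhj : ℕ → ℝ → ParamSpace smin smax l),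
        IsEstimator A B u T (fun _ ht => histOp 𝓚 a b X ht) (X 0) μ₀ Xh Xh μh →
        (∀ j, IsEstimator A B u T (fun t _ => histOpGrid 𝓚 a b j (ξ j) X t)
          (X 0) (gridProj smin smax l j μ₀) (Xhj j) (Xhj j) (μhj j)) →
        TendstoUniformlyOn Xhj Xh atTop (Icc 0 T) ∧
          TendstoUniformlyOn μhj μh atTop (Icc 0 T)) ∧
    -- update laws driven by the observed state
    (∀ (Xh : ℝ → EuclideanSpace ℝ (Fin m)) (μh : ℝ → ParamSpace smin smax l)
        (Xhj : ℕ → ℝ → EuclideanSpace ℝ (Fin m)) (μhj : ℕ → ℝ → ParamSpace smin smax l),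
        IsEstimator A B u T (fun _ ht => histOp 𝓚 a b X ht) (X 0) μ₀ X Xh μh →
        (∀ j, IsEstimator A B u T (fun t _ => histOpGrid 𝓚 a b j (ξ j) X t)
          (X 0) (gridProj smin smax l j μ₀) X (Xhj j) (μhj j)) →
        TendstoUniformlyOn Xhj Xh atTop (Icc 0 T) ∧
          TendstoUniformlyOn μhj μh atTop (Icc 0 T)) := by
  have hM := exists_norm_histOp_le 𝓚 a b X T
  have hH := fun (ε : ℝ) (hε : ε > 0) =>
    eventually_norm_histOp_sub_histOpGrid_le 𝓚 a b X T hs hξ hε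
  refine ⟨fun Xh μh Xhj μhj h h' => ?_, fun Xh μh Xhj μhj h h' => ?_⟩
  -- The signals are the state estimates, so `hZ` holds with equality.
  · exact h.tendstoUniformlyOn h' (fun t ht => (h.state_deriv t ht).continuousWithinAt)
      (fun _ _ _ => le_rfl) hM hH (tendsto_gridProj hs μ₀)
  -- Both signals are `X`, so their difference vanishes.
  · exact h.tendstoUniformlyOn h' X.continuous.continuousOn
      (fun j t _ => by simp) hM hH (tendsto_gridProj hs μ₀)
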